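/- Let $p$ be a prime. For every integer $m\ge 1$ let $(z_j)_{0\le j<p^m}$ and $(u_j)_{0\le j<p^m}$ be tuples with entries in $\{0,1,\dots,p-1\}$ and $(\eta_j)_{0\le j<p^m}$ a tuple of non-negative integers (all depending on $m$) such that $u_j\ne 0$ for all $j$, $\eta_0=0$, and $\eta_j\le\eta_{j+1}\le\eta_j+1$ for $0\le j\le p^m-2$. For $0\le n<p^{p^m}$ with base-$p$ expansion $n=\sum_{j=0}^{p^m-1}e_j(n)p^j$, $e_j(n)\in\{0,\dots,p-1\}$, and for $0\le k<p^m$ let $d_k(n)\in\{0,\dots,p-1\}$ be given by $$d_k(n)\equiv z_k+\sum_{j=0}^{p^m-1}\binom{k+j-\eta_j}{j}u_j\,e_j(n)\pmod p .$$ The affine necklace $\mathcal A_m$ is the word of length $p^m\cdot p^{p^m}$ obtained by concatenating, for $n=0,1,\dots,p^{p^m}-1$ in this order, the words $d_0(n)d_1(n)\dots d_{p^m-1}(n)$. Let $\alpha=0.\alpha_1\alpha_2\alpha_3\ldots\in[0,1)$ be such that its base-$p$ representation $\alpha_1\alpha_2\alpha_3\ldots$ is the concatenation $\mathcal A_1\mathcal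 A_2\mathcal A_3\cdots$ of such affine necklaces. Then the star discrepancy $$D_N^*=\sup_{0<c\le 1}\left|\frac1N\#\{0\le n<N:\ 0\le\{p^n\alpha\}<c\}-c\right|$$ of the sequence $(\{p^n\alpha\})_{n\ge0}$ satisfies $N D_N^*=O_p\big((\log N)^2\big)$; that is, there is a constant $C>0$ depending only on $p$ (not on the chosen parameters) such that $N D_N^*\le C(\log N)^2$ for all integers $N\ge 2$. -/

import Mathlib

/-- The star discrepancy `D_N^*` of the first `N` terms `x 0, …, x (N - 1)` of a sequence of
points of `[0, 1)`: the supremum over `0 < c ≤ 1` of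
`|#{0 ≤ n < N : 0 ≤ x n < c} / N - c|`. -/
noncomputable def starDiscrepancy (x : ℕ → ℝ) (N : ℕ) : ℝ :=
  ⨆ c : Set.Ioc (0 : ℝ) 1,
    |(((Finset.range N).filter (fun n => 0 ≤ x n ∧ x n < (c : ℝ))).card : ℝ) / (N : ℝ) - (c : ℝ)|

/-- Admissibility of the parameters `(z j)`, `(η j)`, `(u j)`, `0 ≤ j < p ^ m`, of an affine
necklace. Only the values at `j < p ^ m` matter. -/
structure IsAdmissible (p m : ℕ) (z η u : ℕ → ℕ) : Prop where
  z_lt : ∀ j < p ^ m, z j < p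
  eta_zero : η 0 = 0
  eta_step : ∀ j, j + 1 < p ^ m → η j ≤ η (j + 1) ∧ η (j + 1) ≤ η j + 1
  u_lt : ∀ j < p ^ m, u j < p
  u_ne_zero : ∀ j < p ^ m, u j ≠ 0

/-- The digit `d_k(n)`; here `n / p ^ j % p` is the `j`-th base-`p` digit of `n`.
For admissible parameters `η j ≤ j`, so that the subtraction is not truncated. -/
def affineDigit (p m : ℕ) (z η u : ℕ → ℕ) (n k : ℕ) : ℕ :=
  ((∑ j ∈ Finset.range (p ^ m), (k + j - η j).choose j * u j * (n / p ^ j % p)) + z k) % p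

/-- The length of the affine necklace of index `m`. -/
def affineLength (p m : ℕ) : ℕ := p ^ m * p ^ p ^ m

/-- The affine necklace of index `m`, as a word: its letter at position `i`,
`0 ≤ i < affineLength p m`. It is the concatenation, for `n = 0, …, p ^ p ^ m - 1`, of the words
`d_0(n) d_1(n) … d_{p ^ m - 1}(n)`. -/
def affineNecklace (p m : ℕ) (z η u : ℕ → ℕ) (i : ℕ) : ℕ :=
  affineDigit p m z η u (i / p ^ m) (i % p ^ m)

/-- The sequence of digits `a 0, a 1, …` is the concatenation of the affine necklaces of index
`m = 1, 2, 3, …` with parameters `z m`, `η m`, `u m`. -/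
def IsAffineConcatenation (p : ℕ) (z η u : ℕ → ℕ → ℕ) (a : ℕ → Fin p) : Prop :=
  ∀ m, 1 ≤ m → ∀ i < affineLength p m,
    (a ((∑ j ∈ Finset.Ico 1 m, affineLength p j) + i) : ℕ) =
      affineNecklace p m (z m) (η m) (u m) i

/-! Over `ZMod p`, the letter in column `κ` of the word of `n` is an affine function of the digits
of `n`, with coefficients `necklaceCoeff`. The key fact is `eq_of_window_eq`: among `p ^ j` aligned
consecutive words, `j ≤ p ^ m`, the windows of length `j` starting in a fixed column are distinct,
the last word excepted. The corresponding points then lie in distinct intervals of length `p ^ (-j)`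
and contribute O(1) to the discrepancy (`abs_sum_discrepancyTerm_le_three`), so the block
contributes O(`p ^ m`) over all columns. A necklace prefix consists of at most `p` such blocks for
each `j < p ^ m`, possibly one full block, and a partial word. This gives O(`p ^ (2 * m)`), and
earlier necklaces add no more than that order. Reaching necklace `m` forces `N ≥ 2 ^ p ^ (m - 1)`,
whence the squared logarithm. For a window inside one word, distinctness is nonsingularity of a
binomial matrix. A window running into the next word mixes the digits of `x` and `x + 1`, and the
carry breaks linearity; `mod_pow_eq_of_window` handles this. -/

/-! ### Binomial coefficients modulo `p` and binomial matrices -/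

/-- In Vandermonde's convolution, `p` divides `(p ^ m).choose b` for `0 < b < p ^ m`, so only `b =
0` survives. -/
theorem choose_add_prime_pow {p : ℕ} (hp : p.Prime) (m x i : ℕ) (hi : i < p ^ m) :
    (((x + p ^ m).choose i : ℕ) : ZMod p) = ((x.choose i : ℕ) : ZMod p) := by
  rw [Nat.add_choose_eq, Nat.cast_sum, Finset.sum_eq_single (i, 0)]
  · simp
  · rintro ⟨a, b⟩ hab hne
    have hab' : a + b = i := by simpa using hab
    have hb : b ≠ 0 := by
      rintro rfl
      exact hne (by simp at hab'; simp [hab'])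
    have : ((p ^ m).choose b : ZMod p) = 0 :=
      (ZMod.natCast_eq_zero_iff _ _).2 (hp.dvd_choose_pow hb (by omega))
    simp [this]
  · intro h
    simp at h

/-- Subtracting consecutive rows kills column 0 and, by Pascal's rule, leaves a smaller matrix of
the same shape. The shift `s` varies with the column to accommodate `η`. -/
theorem eq_zero_of_sum_choose_mul_eq_zero {R : Type*} [CommRing R] :
    ∀ (j : ℕ) (s : ℕ → ℕ) (w : ℕ → R),
      (∀ r < j, ∑ i ∈ Finset.range j, ((r + s i).choose i : R) * w i = 0) → ∀ i < j, w i = 0 := by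
  intro j
  induction j with
  | zero => intro s w _ i hi; omega
  | succ j ih =>
    intro s w h
    have hsucc : ∀ i < j, w (i + 1) = 0 := by
      refine ih (fun i => s (i + 1)) (fun i => w (i + 1)) fun r hr => ?_
      have h1 := h (r + 1) (by omega)
      have h0 := h r (by omega)
      rw [Finset.sum_range_succ'] at h0 h1
      have h2 : ∑ i ∈ Finset.range j, ((r + 1 + s (i + 1)).choose (i + 1) : R) * w (i + 1) =
          ∑ i ∈ Finset.range j, ((r + s (i + 1)).choose i : R) * w (i + 1) +
          ∑ i ∈ Finset.range j, ((r + s (i + 1)).choose (i + 1) : R) * w (i + 1) := by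
        rw [← Finset.sum_add_distrib]
        refine Finset.sum_congr rfl fun i _ => ?_
        rw [show r + 1 + s (i + 1) = (r + s (i + 1)) + 1 by omega, Nat.choose_succ_succ]
        push_cast
        ring
      rw [h2] at h1
      simp only [Nat.choose_zero_right] at h0 h1
      linear_combination h1 - h0
    rintro (_ | i) hi
    · have h0 := h 0 (by omega)
      rw [Finset.sum_range_succ', Finset.sum_eq_zero] at h0
      · simpa using h0
      · intro i hi
        rw [hsucc i (Finset.mem_range.1 hi), mul_zero]
    · exact hsucc i (by omega)

/-! ### Digits as residues and the coefficients of a necklace -/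

/-- The base-`p` digit of `x` at place `i`, as a residue. -/
def digitMod (p i x : ℕ) : ZMod p := ((x / p ^ i % p : ℕ) : ZMod p)

theorem digitMod_eq_iff {p : ℕ} {i x y : ℕ} :
    digitMod p i x = digitMod p i y ↔ x / p ^ i % p = y / p ^ i % p := by
  rw [digitMod, digitMod, ZMod.natCast_eq_natCast_iff, Nat.ModEq, Nat.mod_mod, Nat.mod_mod]

theorem mod_pow_eq_of_digitMod_eq {p : ℕ} {x y : ℕ} :
    ∀ j : ℕ, (∀ i < j, digitMod p i x = digitMod p i y) → x % p ^ j = y % p ^ j := by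
  intro j
  induction j with
  | zero => intro _; simp [Nat.mod_one]
  | succ j ih =>
    intro h
    rw [Nat.mod_pow_succ, Nat.mod_pow_succ, ih fun i hi => h i (by omega),
      digitMod_eq_iff.1 (h j (by omega))]

theorem digitMod_eq_of_mod_pow_eq {p : ℕ} {x y j i : ℕ} (h : x % p ^ j = y % p ^ j) (hi : i < j) :
    digitMod p i x = digitMod p i y := by
  have key : ∀ x : ℕ, x / p ^ i % p = x % p ^ j / p ^ i % p := by
    intro x
    obtain ⟨d, rfl⟩ : ∃ d, j = i + (d + 1) := ⟨j - i - 1, by omega⟩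
    rw [pow_add, Nat.mod_mul_right_div_self, pow_succ', Nat.mod_mul_right_mod]
  rw [digitMod, digitMod, key x, key y, h]

/-- The coefficient of the `i`-th base-`p` digit in the letters of the `κ`-th column of an affine
necklace. -/
def necklaceCoeff (p : ℕ) (η u : ℕ → ℕ) (κ i : ℕ) : ZMod p :=
  ((κ + i - η i).choose i : ZMod p) * (u i : ZMod p)

namespace IsAdmissible

variable {p m : ℕ} {z η u : ℕ → ℕ}

theorem eta_mono (h : IsAdmissible p m z η u) {i j : ℕ} (hij : i ≤ j) (hj : j < p ^ m) :
    η i ≤ η j ∧ η j + i ≤ η i + j := by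
  induction j, hij using Nat.le_induction with
  | base => simp
  | succ j hij ih =>
    have h1 := h.eta_step j hj
    have h2 := ih (by omega)
    omega

theorem eta_le (h : IsAdmissible p m z η u) {j : ℕ} (hj : j < p ^ m) : η j ≤ j := by
  have h1 := h.eta_mono (Nat.zero_le j) hj
  have h2 := h.eta_zero
  omega

theorem coeff_add_period (h : IsAdmissible p m z η u) (hp : p.Prime) {κ i : ℕ} (hi : i < p ^ m) :
    necklaceCoeff p η u (κ + p ^ m) i = necklaceCoeff p η u κ i := by
  have h1 := h.eta_le hi
  rw [necklaceCoeff, necklaceCoeff, ← choose_add_prime_pow hp m (κ + i - η i) i hi,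
    show κ + p ^ m + i - η i = κ + i - η i + p ^ m by omega]

/-- Together with `coeff_eq_zero_of_le`: digit `i` affects neither the first `η i` nor the last `i -
η i` letters of a word. -/
theorem coeff_eq_zero_of_lt {κ i : ℕ} (h : κ < η i) (hi : η i ≤ i) :
    necklaceCoeff p η u κ i = 0 := by
  rw [necklaceCoeff, Nat.choose_eq_zero_of_lt (by omega)]
  simp

theorem coeff_eq_zero_of_le (hp : p.Prime) {κ i : ℕ} (hi : i < p ^ m)
    (hκ : κ < p ^ m) (hle : p ^ m + η i ≤ κ + i) : necklaceCoeff p η u κ i = 0 := by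
  rw [necklaceCoeff, show κ + i - η i = (κ + i - η i - p ^ m) + p ^ m by omega,
    choose_add_prime_pow hp m _ i hi, Nat.choose_eq_zero_of_lt (by omega)]
  simp

theorem digitMod_eq_of_rows (h : IsAdmissible p m z η u) (hp : p.Prime) {j : ℕ} (hj : j ≤ p ^ m)
    (k x y : ℕ)
    (hrow : ∀ r < j, ∑ i ∈ Finset.range j,
      necklaceCoeff p η u (k + r) i * (digitMod p i x - digitMod p i y) = 0) :
    x % p ^ j = y % p ^ j := by
  have : Fact p.Prime := ⟨hp⟩
  refine mod_pow_eq_of_digitMod_eq j fun i hi => ?_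
  have key := eq_zero_of_sum_choose_mul_eq_zero j (fun i => k + (i - η i))
    (fun i => (u i : ZMod p) * (digitMod p i x - digitMod p i y)) (fun r hr => by
      rw [← hrow r hr]
      refine Finset.sum_congr rfl fun i hi => ?_
      have h1 := h.eta_le (j := i) (by have := Finset.mem_range.1 hi; omega)
      rw [necklaceCoeff, show r + (k + (i - η i)) = k + r + i - η i by omega, mul_assoc]) i hi
  rcases mul_eq_zero.1 key with h0 | h0
  · exact absurd (Nat.eq_zero_of_dvd_of_lt ((ZMod.natCast_eq_zero_iff _ _).1 h0)
      (h.u_lt i (by omega))) (h.u_ne_zero i (by omega))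
  · exact sub_eq_zero.1 h0

theorem sum_range_coeff_eq_zero {i₀ j κ x y : ℕ}
    (h0 : ∀ i, i₀ ≤ i → i < j → necklaceCoeff p η u κ i = 0)
    (hxy : x % p ^ i₀ = y % p ^ i₀) :
    ∑ i ∈ Finset.range j, necklaceCoeff p η u κ i * (digitMod p i x - digitMod p i y) = 0 := by
  refine Finset.sum_eq_zero fun i hi => ?_
  rcases lt_or_ge i i₀ with hlt | hge
  · rw [digitMod_eq_of_mod_pow_eq hxy hlt, sub_self, mul_zero]
  · rw [h0 i hge (Finset.mem_range.1 hi), zero_mul]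

theorem sum_range_coeff_shrink {i₀ j κ x y : ℕ} (hij : i₀ ≤ j)
    (h0 : ∀ i, i₀ ≤ i → i < j → necklaceCoeff p η u κ i = 0)
    (hs : ∑ i ∈ Finset.range j,
      necklaceCoeff p η u κ i * (digitMod p i x - digitMod p i y) = 0) :
    ∑ i ∈ Finset.range i₀, necklaceCoeff p η u κ i * (digitMod p i x - digitMod p i y) = 0 := by
  rw [← hs]
  refine Finset.sum_subset (Finset.range_mono hij) fun i hi hi' => ?_
  rw [h0 i (by simpa using hi') (Finset.mem_range.1 hi), zero_mul]

/-- A window of `j` consecutive letters that starts `l` letters before the end of the word of `x`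
and continues in the word of `x + 1` determines `x` modulo `p ^ j`. -/
theorem mod_pow_eq_of_window (h : IsAdmissible p m z η u) (hp : p.Prime) :
    ∀ j ≤ p ^ m, ∀ l ≤ j, ∀ x y : ℕ,
      (∀ κ, p ^ m ≤ κ + l → κ < p ^ m → ∑ i ∈ Finset.range j,
        necklaceCoeff p η u κ i * (digitMod p i x - digitMod p i y) = 0) →
      (∀ κ, κ + l < j → ∑ i ∈ Finset.range j,
        necklaceCoeff p η u κ i * (digitMod p i (x + 1) - digitMod p i (y + 1)) = 0) →
      x % p ^ j = y % p ^ j := by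
  classical
  intro j
  induction j using Nat.strong_induction_on with
  | _ j ih =>
  intro hj l hl x y hA hB
  rcases Nat.eq_zero_or_pos j with rfl | hj0
  · simp [Nat.mod_one]
  -- Carries only move upwards, so low digits of `x` determine those of `x + 1`.
  have hsucc : ∀ {a : ℕ}, x % p ^ a = y % p ^ a → (x + 1) % p ^ a = (y + 1) % p ^ a :=
    fun h => Nat.ModEq.add_right 1 h
  rcases le_or_gt (j - l) (η (j - 1)) with hc | hc
  -- Digits from `i₀` on are invisible in the `j - l` letters of the second word. A subwindow of
  -- length `i₀` sees only the digits below `i₀`, so induction recovers these.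
  · have hex : ∃ i, j - l ≤ η i := ⟨j - 1, hc⟩
    set i₀ := Nat.find hex with hi₀
    have hspec : j - l ≤ η i₀ := Nat.find_spec hex
    have hle : i₀ ≤ j - 1 := Nat.find_min' hex hc
    have heq : η i₀ = j - l := by
      rcases Nat.eq_zero_or_pos i₀ with h0 | hpos
      · have h1 := h.eta_zero
        rw [h0] at hspec ⊢
        omega
      · have h1 := Nat.find_min hex (m := i₀ - 1) (by omega)
        have h2 := (h.eta_step (i₀ - 1) (by omega)).2
        rw [show i₀ - 1 + 1 = i₀ by omega] at h2
        omega
    have hη₀ := h.eta_le (j := i₀) (by omega)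
    have hz1 : ∀ κ, κ + l < j → ∀ i, i₀ ≤ i → i < j → necklaceCoeff p η u κ i = 0 := by
      intro κ hκ i hi hij
      have := (h.eta_mono hi (by omega)).1
      exact coeff_eq_zero_of_lt (by omega) (h.eta_le (by omega))
    have hmod : x % p ^ i₀ = y % p ^ i₀ := by
      refine ih i₀ (by omega) (by omega) (i₀ - (j - l)) (by omega) x y ?_ ?_
      · intro κ h1 h2
        refine sum_range_coeff_shrink (by omega) (fun i hi hij => ?_) (hA κ (by omega) h2)
        have := (h.eta_mono hi (by omega)).2
        exact coeff_eq_zero_of_le hp (by omega) h2 (by omega)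
      · intro κ h1
        exact sum_range_coeff_shrink (by omega) (hz1 κ (by omega)) (hB κ (by omega))
    -- Extend the word of `x` periodically past its end: the added rows involve only digits below
    -- `i₀`, already known to agree. All `j` rows now concern `x` alone.
    refine h.digitMod_eq_of_rows hp hj (p ^ m - l) x y fun r hr => ?_
    rcases lt_or_ge (p ^ m - l + r) (p ^ m) with hlt | hge
    · exact hA _ (by omega) hlt
    · refine sum_range_coeff_eq_zero (fun i hi hij => ?_) hmod
      rw [show p ^ m - l + r = (r - l) + p ^ m by omega, h.coeff_add_period hp (by omega)]
      exact hz1 _ (by omega) i hi hij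
  -- Mirror case: digits from `i₁` on are invisible in the last `l` letters of the first word, so
  -- the linear system is completed for `x + 1` instead.
  · have hex : ∃ i, l ≤ i - η i := ⟨j - 1, by omega⟩
    set i₁ := Nat.find hex with hi₁
    have hspec : l ≤ i₁ - η i₁ := Nat.find_spec hex
    have hle : i₁ ≤ j - 1 := Nat.find_min' hex (by omega)
    have hη₁ := h.eta_le (j := i₁) (by omega)
    have heq : i₁ = l + η i₁ := by
      rcases Nat.eq_zero_or_pos i₁ with h0 | hpos
      · omega
      · have h1 := Nat.find_min hex (m := i₁ - 1) (by omega)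
        have h2 := (h.eta_step (i₁ - 1) (by omega)).1
        rw [show i₁ - 1 + 1 = i₁ by omega] at h2
        omega
    have hz1 : ∀ κ, p ^ m ≤ κ + l → κ < p ^ m → ∀ i, i₁ ≤ i → i < j →
        necklaceCoeff p η u κ i = 0 := by
      intro κ h1 h2 i hi hij
      have := (h.eta_mono hi (by omega)).2
      exact coeff_eq_zero_of_le hp (by omega) h2 (by omega)
    have hmod : x % p ^ i₁ = y % p ^ i₁ := by
      refine ih i₁ (by omega) (by omega) l (by omega) x y ?_ ?_
      · intro κ h1 h2
        exact sum_range_coeff_shrink (by omega) (hz1 κ h1 h2) (hA κ h1 h2)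
      · intro κ h1
        refine sum_range_coeff_shrink (by omega) (fun i hi hij => ?_) (hB κ (by omega))
        have := (h.eta_mono hi (by omega)).1
        exact coeff_eq_zero_of_lt (by omega) (h.eta_le (by omega))
    have hfin : (x + 1) % p ^ j = (y + 1) % p ^ j := by
      refine h.digitMod_eq_of_rows hp hj (p ^ m - l) (x + 1) (y + 1) fun r hr => ?_
      rcases lt_or_ge (p ^ m - l + r) (p ^ m) with hlt | hge
      · exact sum_range_coeff_eq_zero (hz1 _ (by omega) hlt) (hsucc hmod)
      · rw [← hB (r - l) (by omega)]
        refine Finset.sum_congr rfl fun i hi => ?_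
        have := Finset.mem_range.1 hi
        rw [show p ^ m - l + r = (r - l) + p ^ m by omega, h.coeff_add_period hp (by omega)]
    exact Nat.ModEq.add_right_cancel' 1 hfin

theorem natCast_affineDigit (n k : ℕ) :
    (affineDigit p m z η u n k : ZMod p) =
      ∑ i ∈ Finset.range (p ^ m), necklaceCoeff p η u k i * digitMod p i n + z k := by
  simp [affineDigit, necklaceCoeff, digitMod]

theorem sum_coeff_eq_zero_of_affineDigit_eq {j x y κ : ℕ} (hj : j ≤ p ^ m)
    (hdiv : x / p ^ j = y / p ^ j)
    (hd : affineDigit p m z η u x κ = affineDigit p m z η u y κ) :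
    ∑ i ∈ Finset.range j, necklaceCoeff p η u κ i * (digitMod p i x - digitMod p i y) = 0 := by
  have h1 := congrArg (Nat.cast : ℕ → ZMod p) hd
  rw [natCast_affineDigit, natCast_affineDigit, add_left_inj, ← sub_eq_zero,
    ← Finset.sum_sub_distrib] at h1
  rw [← h1]
  simp_rw [← mul_sub]
  refine Finset.sum_subset (Finset.range_mono hj) fun i _ hi => ?_
  have hi' : j ≤ i := by simpa using hi
  have : digitMod p i x = digitMod p i y := by
    rw [digitMod, digitMod, show i = j + (i - j) by omega, pow_add, ← Nat.div_div_eq_div_mul,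
      ← Nat.div_div_eq_div_mul, hdiv]
  rw [this, sub_self, mul_zero]

theorem affineNecklace_mul_add {n k : ℕ} (hk : k < p ^ m) :
    affineNecklace p m z η u (n * p ^ m + k) = affineDigit p m z η u n k := by
  rw [affineNecklace, Nat.mul_add_mod', Nat.mod_eq_of_lt hk, mul_comm n, Nat.mul_add_div (by omega),
    Nat.div_eq_of_lt hk, add_zero]

/-- In an aligned block of `p ^ j` consecutive words, the windows of length `j` that start in a
given column and do not leave the block are pairwise distinct. -/
theorem eq_of_window_eq (h : IsAdmissible p m z η u) (hp : p.Prime) {j k t s s' : ℕ}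
    (hj : j ≤ p ^ m) (hk : k < p ^ m) (hs : s + 1 < p ^ j) (hs' : s' + 1 < p ^ j)
    (hw : ∀ i < j, affineNecklace p m z η u ((t * p ^ j + s) * p ^ m + k + i) =
      affineNecklace p m z η u ((t * p ^ j + s') * p ^ m + k + i)) : s = s' := by
  have hdiv : ∀ r < p ^ j, (t * p ^ j + r) / p ^ j = t := fun r hr => by
    rw [mul_comm t, Nat.mul_add_div (by omega), Nat.div_eq_of_lt hr, add_zero]
  have hlow : ∀ κ, k ≤ κ → κ < k + j → κ < p ^ m → ∑ i ∈ Finset.range j, necklaceCoeff p η u κ i *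
      (digitMod p i (t * p ^ j + s) - digitMod p i (t * p ^ j + s')) = 0 := by
    intro κ h1 h2 h3
    refine sum_coeff_eq_zero_of_affineDigit_eq (z := z) hj
      (by rw [hdiv s (by omega), hdiv s' (by omega)]) ?_
    have := hw (κ - k) (by omega)
    rwa [add_assoc, add_assoc, show k + (κ - k) = κ by omega, affineNecklace_mul_add h3,
      affineNecklace_mul_add h3] at this
  have hmod : (t * p ^ j + s) % p ^ j = (t * p ^ j + s') % p ^ j := by
    rcases le_or_gt (k + j) (p ^ m) with hkj | hkj
    · exact h.digitMod_eq_of_rows hp hj k _ _ fun r hr =>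
        hlow _ (by omega) (by omega) (by omega)
    · refine h.mod_pow_eq_of_window hp j hj (p ^ m - k) (by omega) _ _
        (fun κ h1 h2 => hlow κ (by omega) (by omega) h2) fun κ h1 => ?_
      -- Since `s + 1` and `s' + 1` stay below `p ^ j`, the following words also share all digits
      -- from place `j` on.
      refine sum_coeff_eq_zero_of_affineDigit_eq (z := z) hj
        (by rw [add_assoc, add_assoc, hdiv _ hs, hdiv _ hs']) ?_
      have := hw (κ + (p ^ m - k)) (by omega)
      have e : ∀ r, (t * p ^ j + r) * p ^ m + k + (κ + (p ^ m - k)) =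
          (t * p ^ j + r + 1) * p ^ m + κ := fun r => by
        rw [add_mul (t * p ^ j + r) 1]
        omega
      rwa [e, e, affineNecklace_mul_add (by omega), affineNecklace_mul_add (by omega)] at this
  rwa [Nat.mul_add_mod', Nat.mul_add_mod', Nat.mod_eq_of_lt (by omega),
    Nat.mod_eq_of_lt (by omega)] at hmod

end IsAdmissible

/-! ### Words of digits and fractional parts -/

/-- The value of the word of length `j` at position `q` of the digit sequence `a`. -/
def wordValue {p : ℕ} (a : ℕ → Fin p) (q : ℕ) : ℕ → ℕ
  | 0 => 0
  | j + 1 => p * wordValue a q j + a (q + j)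

theorem wordValue_lt {p : ℕ} (a : ℕ → Fin p) (q j : ℕ) : wordValue a q j < p ^ j := by
  induction j with
  | zero => simp [wordValue]
  | succ j ih =>
    have h1 := (a (q + j)).isLt
    have h2 : p * (wordValue a q j + 1) ≤ p * p ^ j := Nat.mul_le_mul_left p ih
    rw [wordValue, pow_succ']
    rw [mul_add] at h2
    omega

theorem digit_eq_of_wordValue_eq {p : ℕ} (a : ℕ → Fin p) (q q' j : ℕ)
    (h : wordValue a q j = wordValue a q' j) : ∀ i < j, (a (q + i) : ℕ) = a (q' + i) := by
  induction j with
  | zero => intro i hi; omega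
  | succ j ih =>
    intro i hi
    have h1 := congrArg (· % p) h
    have h2 := congrArg (· / p) h
    have hp : 0 < p := Fin.pos (a 0)
    simp only [wordValue, Nat.mul_add_mod, Nat.mod_eq_of_lt (Fin.isLt _)] at h1
    simp only [wordValue, Nat.mul_add_div hp, Nat.div_eq_of_lt (Fin.isLt _), add_zero] at h2
    rcases Nat.lt_succ_iff_lt_or_eq.1 hi with hlt | rfl
    · exact ih h2 i hlt
    · exact h1

theorem pow_mul_ofDigits_shift {p : ℕ} (a : ℕ → Fin p) (q j : ℕ) :
    (p : ℝ) ^ j * Real.ofDigits (fun i => a (i + q)) =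
      wordValue a q j + Real.ofDigits (fun i => a (i + (q + j))) := by
  have hp : (p : ℝ) ≠ 0 := by exact_mod_cast (Fin.pos (a 0)).ne'
  induction j with
  | zero => simp [wordValue]
  | succ j ih =>
    have h1 := Real.ofDigits_eq_sum_add_ofDigits (fun i => a (i + (q + j))) 1
    have e : (fun i => a (i + 1 + (q + j))) = fun i => a (i + (q + (j + 1))) := by
      funext i
      congr 1
      ring
    simp only [Finset.sum_range_one, Real.ofDigitsTerm, zero_add, pow_one, e] at h1
    rw [pow_succ', mul_assoc, ih, h1, wordValue]
    push_cast
    field_simp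
    ring

/-- The hypothesis excludes a tail consisting only of digits `p - 1`, whose value 1 would wrap to 0.
The upper bound is not strict because digits after the window may all be `p - 1`. -/
theorem fract_pow_mul_ofDigits {p : ℕ} (a : ℕ → Fin p) (n j : ℕ)
    (hW : wordValue a n j + 1 < p ^ j) :
    (wordValue a n j : ℝ) ≤ (p : ℝ) ^ j * Int.fract ((p : ℝ) ^ n * Real.ofDigits a) ∧
      (p : ℝ) ^ j * Int.fract ((p : ℝ) ^ n * Real.ofDigits a) ≤ wordValue a n j + 1 := by
  have h0 := pow_mul_ofDigits_shift a 0 n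
  simp only [add_zero, zero_add] at h0
  have h1 := pow_mul_ofDigits_shift a n j
  have hlow := Real.ofDigits_nonneg (fun i => a (i + (n + j)))
  have hupp := Real.ofDigits_le_one (fun i => a (i + (n + j)))
  have hW' : (wordValue a n j : ℝ) + 1 < (p : ℝ) ^ j := by exact_mod_cast hW
  have hpos : (0 : ℝ) < (p : ℝ) ^ j := by linarith [(wordValue a n j).cast_nonneg (α := ℝ)]
  have hlt : Real.ofDigits (fun i => a (i + n)) < 1 := by
    by_contra! hge
    have := mul_le_mul_of_nonneg_left hge hpos.le
    linarith
  rw [h0, Int.fract_natCast_add, Int.fract_eq_self.2 ⟨Real.ofDigits_nonneg _, hlt⟩, h1]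
  constructor <;> linarith

/-! ### Discrepancy of points in distinct intervals -/

/-- The contribution of the `n`-th term to the discrepancy of `y` with respect to `[0, c)`. -/
noncomputable def discrepancyTerm (y : ℕ → ℝ) (c : ℝ) (n : ℕ) : ℝ :=
  (if y n < c then 1 else 0) - c

theorem abs_discrepancyTerm_le_one (y : ℕ → ℝ) {c : ℝ} (hc : c ∈ Set.Ioc (0 : ℝ) 1) (n : ℕ) :
    |discrepancyTerm y c n| ≤ 1 := by
  have h1 := hc.1
  have h2 := hc.2
  rw [discrepancyTerm, abs_le]
  split_ifs <;> constructor <;> linarith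

theorem sum_range_discrepancyTerm (y : ℕ → ℝ) (c : ℝ) (N : ℕ) :
    ∑ n ∈ Finset.range N, discrepancyTerm y c n =
      (((Finset.range N).filter (fun n => y n < c)).card : ℝ) - N * c := by
  simp [discrepancyTerm, Finset.sum_sub_distrib]

theorem abs_sum_range_discrepancyTerm_le (y : ℕ → ℝ) {c : ℝ} (hc : c ∈ Set.Ioc (0 : ℝ) 1)
    (f : ℕ → ℕ) (N : ℕ) : |∑ n ∈ Finset.range N, discrepancyTerm y c (f n)| ≤ N :=
  (Finset.abs_sum_le_sum_abs _ _).trans <|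
    (Finset.sum_le_sum fun _ _ => abs_discrepancyTerm_le_one y hc _).trans (by simp)

/-- If the intervals `[W s / Q, (W s + 1) / Q]` containing `y s` are distinct, up to one exceptional
index and one exceptional interval, the discrepancy of `y` is bounded. -/
theorem abs_sum_discrepancyTerm_le_three {Q : ℕ} (W : ℕ → ℕ) (y : ℕ → ℝ) {c : ℝ}
    (hc : c ∈ Set.Ioc (0 : ℝ) 1) (hW : ∀ s < Q, W s < Q)
    (hinj : ∀ s s', s + 1 < Q → s' + 1 < Q → W s = W s' → s = s')
    (hy : ∀ s, W s + 1 < Q → (W s : ℝ) ≤ Q * y s ∧ (Q : ℝ) * y s ≤ W s + 1) :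
    |∑ s ∈ Finset.range Q, discrepancyTerm y c s| ≤ 3 := by
  obtain ⟨hc0, hc1⟩ := hc
  rcases Nat.eq_zero_or_pos Q with rfl | hQ
  · simp
  have hQ' : (0 : ℝ) < Q := by exact_mod_cast hQ
  have hceil : (Q : ℝ) * c ≤ ⌈(Q : ℝ) * c⌉₊ := Nat.le_ceil _
  have hceil' : (⌈(Q : ℝ) * c⌉₊ : ℝ) < Q * c + 1 := Nat.ceil_lt_add_one (by positivity)
  have hceilpos : 0 < ⌈(Q : ℝ) * c⌉₊ := Nat.ceil_pos.2 (by positivity)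
  have hceilQ : ⌈(Q : ℝ) * c⌉₊ ≤ Q := Nat.ceil_le.2 (by nlinarith)
  have hcard : ∀ T : Finset ℕ, ∀ P : ℕ → Prop, ∀ _ : DecidablePred P,
      (∀ s, s + 1 < Q → P s → W s ∈ T) → ((Finset.range Q).filter P).card ≤ T.card + 1 := by
    intro T P _ hP
    have hsub : (Finset.range Q).filter P ⊆
        insert (Q - 1) ((Finset.range (Q - 1)).filter P) := by
      intro s hs
      simp only [Finset.mem_insert, Finset.mem_filter, Finset.mem_range] at hs ⊢
      rcases eq_or_ne s (Q - 1) with h | h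
      · exact Or.inl h
      · exact Or.inr ⟨by omega, hs.2⟩
    refine (Finset.card_le_card hsub).trans ((Finset.card_insert_le _ _).trans ?_)
    refine Nat.add_le_add_right (Finset.card_le_card_of_injOn W ?_ ?_) 1
    · intro s hs
      simp only [Finset.coe_filter, Finset.mem_range, Set.mem_ofPred_eq] at hs
      exact hP s (by omega) hs.2
    · intro s hs s' hs' h
      simp only [Finset.coe_filter, Finset.mem_range, Set.mem_ofPred_eq] at hs hs'
      exact hinj s s' (by omega) (by omega) h
  -- One extra unit is for the interval `Q - 1`, the other for the index `Q - 1`.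
  have hup : ((Finset.range Q).filter (fun s => y s < c)).card ≤ ⌈(Q : ℝ) * c⌉₊ + 1 + 1 := by
    refine (hcard (insert (Q - 1) (Finset.range ⌈(Q : ℝ) * c⌉₊)) _ _ fun s hs hys => ?_).trans
      (Nat.add_le_add_right ((Finset.card_insert_le _ _).trans (by simp)) 1)
    simp only [Finset.mem_insert, Finset.mem_range]
    have h1 := hW s (by omega)
    by_cases h2 : W s + 1 < Q
    · right
      rw [Nat.lt_ceil]
      exact (hy s h2).1.trans_lt (mul_lt_mul_of_pos_left hys hQ')
    · left
      omega
  have hlow : ((Finset.range Q).filter (fun s => ¬ y s < c)).card ≤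
      Q - (⌈(Q : ℝ) * c⌉₊ - 1) + 1 := by
    refine (hcard (Finset.Ico (⌈(Q : ℝ) * c⌉₊ - 1) Q) _ _ fun s hs hys => ?_).trans (by simp)
    have h1 := hW s (by omega)
    rw [Finset.mem_Ico]
    refine ⟨?_, h1⟩
    by_cases h2 : W s + 1 < Q
    · have h3 := mul_le_mul_of_nonneg_left (not_lt.1 hys) hQ'.le
      have h4 : ⌈(Q : ℝ) * c⌉₊ ≤ W s + 1 := by
        rw [Nat.ceil_le]
        push_cast
        exact h3.trans (hy s h2).2
      omega
    · omega
  have hsplit := Finset.card_filter_add_card_filter_not (s := Finset.range Q) (fun s => y s < c)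
  rw [Finset.card_range] at hsplit
  have hup' : (((Finset.range Q).filter (fun s => y s < c)).card : ℝ) ≤
      ⌈(Q : ℝ) * c⌉₊ + 1 + 1 := by exact_mod_cast hup
  have hlow' : (⌈(Q : ℝ) * c⌉₊ : ℝ) ≤
      ((Finset.range Q).filter (fun s => y s < c)).card + 2 := by
    have : ⌈(Q : ℝ) * c⌉₊ ≤ ((Finset.range Q).filter (fun s => y s < c)).card + 2 := by omega
    exact_mod_cast this
  rw [sum_range_discrepancyTerm, abs_le]
  constructor <;> linarith

theorem sum_range_mul_eq_sum_sum {M : Type*} [AddCommMonoid M] (f : ℕ → M) (A P : ℕ) :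
    ∑ i ∈ Finset.range (A * P), f i =
      ∑ k ∈ Finset.range P, ∑ s ∈ Finset.range A, f (s * P + k) := by
  rw [Finset.sum_comm]
  induction A with
  | zero => simp
  | succ A ih => rw [add_mul, one_mul, Finset.sum_range_add, ih, Finset.sum_range_succ]

theorem sum_range_add_eq {f : ℕ → ℝ} (b c : ℕ) :
    ∑ i ∈ Finset.range (b + c), f i =
      ∑ i ∈ Finset.range b, f i + ∑ i ∈ Finset.range c, f (b + i) := Finset.sum_range_add _ _ _

/-! ### Discrepancy within one necklace -/

section Necklace

variable {p m : ℕ} {z η u : ℕ → ℕ} {a : ℕ → Fin p} {B : ℕ} {c : ℝ}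

theorem abs_sum_aligned_block_le (h : IsAdmissible p m z η u) (hp : p.Prime)
    (ha : ∀ i < affineLength p m, (a (B + i) : ℕ) = affineNecklace p m z η u i)
    (hc : c ∈ Set.Ioc (0 : ℝ) 1) {j t : ℕ} (hj : j ≤ p ^ m) (ht : (t + 1) * p ^ j ≤ p ^ p ^ m) :
    |∑ i ∈ Finset.range (p ^ j * p ^ m), discrepancyTerm
      (fun n => Int.fract ((p : ℝ) ^ n * Real.ofDigits a)) c (B + (t * p ^ j * p ^ m + i))| ≤
      3 * (p : ℝ) ^ m := by
  rw [sum_range_mul_eq_sum_sum]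
  refine (Finset.abs_sum_le_sum_abs _ _).trans ?_
  have hcol : ∀ k ∈ Finset.range (p ^ m), |∑ s ∈ Finset.range (p ^ j), discrepancyTerm
      (fun n => Int.fract ((p : ℝ) ^ n * Real.ofDigits a)) c
        (B + (t * p ^ j * p ^ m + (s * p ^ m + k)))| ≤ 3 := by
    intro k hk
    have hk' := Finset.mem_range.1 hk
    have e : ∀ s, t * p ^ j * p ^ m + (s * p ^ m + k) = (t * p ^ j + s) * p ^ m + k := fun s => by
      ring
    simp_rw [e]
    refine abs_sum_discrepancyTerm_le_three
      (fun s => wordValue a (B + ((t * p ^ j + s) * p ^ m + k)) j)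
      (fun s => Int.fract ((p : ℝ) ^ (B + ((t * p ^ j + s) * p ^ m + k)) * Real.ofDigits a)) hc
      (fun s _ => wordValue_lt _ _ _) (fun s s' hs hs' hW => ?_) (fun s hs => ?_)
    · refine h.eq_of_window_eq hp (t := t) hj hk' hs hs' fun i hi => ?_
      have hlen : ∀ r, r + 1 < p ^ j → (t * p ^ j + r) * p ^ m + k + i < affineLength p m := by
        intro r hr
        have h1 : t * p ^ j + r + 1 + 1 ≤ p ^ p ^ m := by
          rw [add_mul] at ht
          omega
        have h2 := Nat.mul_le_mul_right (p ^ m) h1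
        rw [affineLength, mul_comm (p ^ m)]
        rw [add_mul (t * p ^ j + r + 1) 1, add_mul (t * p ^ j + r) 1] at h2
        omega
      rw [← ha _ (hlen s hs), ← ha _ (hlen s' hs')]
      simpa only [add_assoc] using digit_eq_of_wordValue_eq a _ _ j hW i hi
    · have := fract_pow_mul_ofDigits a _ j hs
      exact_mod_cast this
  refine (Finset.sum_le_sum hcol).trans ?_
  simp [mul_comm]

/-- Cut the `n` words along the base-`p` expansion of `n`: a digit at place `j` gives that many
aligned blocks of `p ^ j` words, each costing `3 * p ^ m`. -/
theorem abs_sum_words_le (h : IsAdmissible p m z η u) (hp : p.Prime)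
    (ha : ∀ i < affineLength p m, (a (B + i) : ℕ) = affineNecklace p m z η u i)
    (hc : c ∈ Set.Ioc (0 : ℝ) 1) {n : ℕ} (hn : n ≤ p ^ p ^ m) :
    |∑ i ∈ Finset.range (n * p ^ m), discrepancyTerm
      (fun n => Int.fract ((p : ℝ) ^ n * Real.ofDigits a)) c (B + i)| ≤
      3 * (p : ℝ) ^ m * (p * p ^ m + 1) := by
  set g := discrepancyTerm (fun n => Int.fract ((p : ℝ) ^ n * Real.ofDigits a)) c with hg
  have hK : (0 : ℝ) ≤ 3 * (p : ℝ) ^ m := by positivity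
  have hblocks : ∀ j ≤ p ^ m, ∀ q t : ℕ, (t + q) * p ^ j ≤ p ^ p ^ m →
      |∑ i ∈ Finset.range ((t + q) * p ^ j * p ^ m), g (B + i) -
        ∑ i ∈ Finset.range (t * p ^ j * p ^ m), g (B + i)| ≤ 3 * (p : ℝ) ^ m * q := by
    intro j hj q t
    induction q with
    | zero => intro _; simp
    | succ q ih =>
      intro ht
      have h1 := ih ((Nat.mul_le_mul_right _ (by omega)).trans ht)
      have h2 := abs_sum_aligned_block_le h hp ha hc hj (t := t + q) (by rwa [add_assoc])
      rw [show (t + (q + 1)) * p ^ j * p ^ m = (t + q) * p ^ j * p ^ m + p ^ j * p ^ m by ring,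
        sum_range_add_eq]
      rw [abs_le] at h1 h2 ⊢
      push_cast
      constructor <;> linarith [h1.1, h1.2, h2.1, h2.2]
  have hlevels : ∀ j ≤ p ^ m, |∑ i ∈ Finset.range (n * p ^ m), g (B + i) -
      ∑ i ∈ Finset.range (n / p ^ j * p ^ j * p ^ m), g (B + i)| ≤ 3 * (p : ℝ) ^ m * (p * j) := by
    intro j
    induction j with
    | zero => intro _; simp
    | succ j ih =>
      intro hj
      have h1 := ih (by omega)
      have hd : p * (n / p ^ j / p) + n / p ^ j % p = n / p ^ j := Nat.div_add_mod _ _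
      have h2 := hblocks j (by omega) (n / p ^ j % p) (p * (n / p ^ j / p))
        (by rw [hd]; exact (Nat.div_mul_le_self _ _).trans hn)
      rw [hd] at h2
      have h3 : ((n / p ^ j % p : ℕ) : ℝ) ≤ p := by exact_mod_cast (Nat.mod_lt _ hp.pos).le
      have h4 := mul_le_mul_of_nonneg_left h3 hK
      rw [show n / p ^ (j + 1) * p ^ (j + 1) * p ^ m = p * (n / p ^ j / p) * p ^ j * p ^ m by
        rw [pow_succ, Nat.div_div_eq_div_mul]; ring]
      rw [abs_le] at h1 h2 ⊢
      push_cast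
      constructor <;> linarith [h1.1, h1.2, h2.1, h2.2]
  have h1 := hlevels _ le_rfl
  have h2 := hblocks _ le_rfl (n / p ^ p ^ m) 0
    (by rw [zero_add]; exact (Nat.div_mul_le_self _ _).trans hn)
  have h3 : ((n / p ^ p ^ m : ℕ) : ℝ) ≤ 1 := by
    exact_mod_cast Nat.div_le_of_le_mul (by rwa [mul_one])
  have h4 := mul_le_mul_of_nonneg_left h3 hK
  simp only [zero_add, zero_mul, Finset.range_zero, Finset.sum_empty, sub_zero] at h2
  push_cast at h1
  rw [abs_le] at h1 h2 ⊢
  constructor <;> linarith [h1.1, h1.2, h2.1, h2.2]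

theorem abs_sum_necklace_prefix_le (h : IsAdmissible p m z η u) (hp : p.Prime)
    (ha : ∀ i < affineLength p m, (a (B + i) : ℕ) = affineNecklace p m z η u i)
    (hc : c ∈ Set.Ioc (0 : ℝ) 1) {M : ℕ} (hM : M ≤ affineLength p m) :
    |∑ i ∈ Finset.range M, discrepancyTerm
      (fun n => Int.fract ((p : ℝ) ^ n * Real.ofDigits a)) c (B + i)| ≤
      7 * (p : ℝ) * ((p : ℝ) ^ m) ^ 2 := by
  have hP : 0 < p ^ m := pow_pos hp.pos m
  have h1 := abs_sum_words_le h hp ha hc (n := M / p ^ m) (Nat.div_le_of_le_mul hM)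
  have h2 := abs_sum_range_discrepancyTerm_le
    (fun n => Int.fract ((p : ℝ) ^ n * Real.ofDigits a)) hc
    (fun i => B + (M / p ^ m * p ^ m + i)) (M % p ^ m)
  have h3 : ((M % p ^ m : ℕ) : ℝ) ≤ (p : ℝ) ^ m := by exact_mod_cast (Nat.mod_lt _ hP).le
  have hp1 : (1 : ℝ) ≤ p := by exact_mod_cast hp.one_lt.le
  have hP1 : (1 : ℝ) ≤ (p : ℝ) ^ m := by exact_mod_cast hP
  have h4 : (p : ℝ) ^ m ≤ p * ((p : ℝ) ^ m) ^ 2 := by nlinarith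
  conv_lhs => rw [← Nat.div_add_mod' M (p ^ m), sum_range_add_eq]
  refine (abs_add_le _ _).trans ?_
  nlinarith

end Necklace

/-! ### Concatenation of the necklaces and the final bound -/

theorem abs_sum_concatenation_le {p : ℕ} (hp : p.Prime) {z η u : ℕ → ℕ → ℕ}
    (h : ∀ m, 1 ≤ m → IsAdmissible p m (z m) (η m) (u m)) {a : ℕ → Fin p}
    (ha : IsAffineConcatenation p z η u a) {c : ℝ} (hc : c ∈ Set.Ioc (0 : ℝ) 1) {m : ℕ}
    (hm : 1 ≤ m) :
    |∑ i ∈ Finset.range (∑ j ∈ Finset.Ico 1 m, affineLength p j), discrepancyTerm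
      (fun n => Int.fract ((p : ℝ) ^ n * Real.ofDigits a)) c i| ≤
      7 * (p : ℝ) * ((p : ℝ) ^ m) ^ 2 := by
  have hp2 : (2 : ℝ) ≤ p := by exact_mod_cast hp.two_le
  induction m, hm using Nat.le_induction with
  | base => simp; positivity
  | succ m hm ih =>
    rw [Finset.sum_Ico_succ_top hm, sum_range_add_eq]
    have h1 := abs_sum_necklace_prefix_le (h m hm) hp (ha m hm) hc le_rfl
    refine (abs_add_le _ _).trans ((add_le_add ih h1).trans ?_)
    -- The bound grows by `p ^ 2 ≥ 4` with `m`, which absorbs the doubling.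
    have h2 : (0 : ℝ) ≤ 7 * p * ((p : ℝ) ^ m) ^ 2 := by positivity
    have h3 : (4 : ℝ) ≤ (p : ℝ) ^ 2 := by nlinarith
    calc _ ≤ (7 * p * ((p : ℝ) ^ m) ^ 2) * (p : ℝ) ^ 2 := by nlinarith
      _ = _ := by ring

theorem exists_necklace_index {p : ℕ} (hp : p.Prime) (N : ℕ) :
    ∃ m, 1 ≤ m ∧ ∑ j ∈ Finset.Ico 1 m, affineLength p j ≤ N ∧
      N < ∑ j ∈ Finset.Ico 1 (m + 1), affineLength p j := by
  have hgrow : ∀ m, m ≤ ∑ j ∈ Finset.Ico 1 (m + 1), affineLength p j := by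
    intro m
    have h1 : ∑ _j ∈ Finset.Ico 1 (m + 1), 1 ≤ ∑ j ∈ Finset.Ico 1 (m + 1), affineLength p j :=
      Finset.sum_le_sum fun j _ =>
        Nat.mul_pos (pow_pos hp.pos _) (pow_pos hp.pos _)
    simpa using h1
  have hex : ∃ m, N < ∑ j ∈ Finset.Ico 1 (m + 1), affineLength p j := ⟨N + 1, hgrow (N + 1)⟩
  classical
  have hpos : Nat.find hex ≠ 0 := by
    intro h0
    have := Nat.find_spec hex
    rw [h0] at this
    simp at this
  refine ⟨Nat.find hex, by omega, ?_, Nat.find_spec hex⟩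
  have := Nat.find_min hex (m := Nat.find hex - 1) (by omega)
  rw [Nat.sub_add_cancel (by omega)] at this
  omega

theorem pow_mul_log_two_le_log {p : ℕ} (hp : p.Prime) {m N : ℕ} (hm : 1 ≤ m) (hN : 2 ≤ N)
    (hle : ∑ j ∈ Finset.Ico 1 m, affineLength p j ≤ N) :
    (p : ℝ) ^ m * Real.log 2 ≤ p * Real.log N := by
  obtain ⟨m, rfl⟩ : ∃ d, m = d + 1 := ⟨m - 1, by omega⟩
  have key : 2 ^ p ^ m ≤ N := by
    -- In the first necklace no complete one precedes, and `2 ≤ N` itself suffices.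
    rcases Nat.eq_zero_or_pos m with rfl | hm0
    · simpa using hN
    · refine le_trans ?_ ((Finset.single_le_sum (f := affineLength p) (fun _ _ => Nat.zero_le _)
        (Finset.mem_Ico.2 ⟨hm0, Nat.lt_succ_self m⟩)).trans hle)
      exact (Nat.pow_le_pow_left hp.two_le _).trans (Nat.le_mul_of_pos_left _ (pow_pos hp.pos m))
  have h1 : Real.log ((2 : ℝ) ^ p ^ m) ≤ Real.log N :=
    Real.log_le_log (by positivity) (by exact_mod_cast key)
  rw [Real.log_pow] at h1
  push_cast at h1
  rw [pow_succ', mul_assoc]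
  exact mul_le_mul_of_nonneg_left h1 (Nat.cast_nonneg p)

theorem mul_starDiscrepancy_le {x : ℕ → ℝ} (hx : ∀ n, 0 ≤ x n) {N : ℕ} (hN : 0 < N) {K : ℝ}
    (hK : ∀ c ∈ Set.Ioc (0 : ℝ) 1, |∑ n ∈ Finset.range N, discrepancyTerm x c n| ≤ K) :
    N * starDiscrepancy x N ≤ K := by
  have hN' : (0 : ℝ) < N := by exact_mod_cast hN
  have : Nonempty (Set.Ioc (0 : ℝ) 1) := ⟨⟨1, by norm_num⟩⟩
  rw [mul_comm, ← le_div_iff₀ hN', starDiscrepancy]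
  refine ciSup_le fun c => ?_
  rw [le_div_iff₀ hN']
  refine le_trans (le_of_eq ?_) (hK c c.2)
  rw [sum_range_discrepancyTerm]
  nth_rewrite 2 [← abs_of_pos hN']
  rw [← abs_mul]
  simp only [hx, true_and]
  congr 1
  field_simp

theorem corollary2 (p : ℕ) (hp : p.Prime) :
    ∃ C : ℝ, 0 < C ∧
      ∀ z η u : ℕ → ℕ → ℕ, (∀ m, 1 ≤ m → IsAdmissible p m (z m) (η m) (u m)) →
      ∀ a : ℕ → Fin p, IsAffineConcatenation p z η u a →
      ∀ α : ℝ, α ∈ Set.Ico (0 : ℝ) 1 → Real.ofDigits a = α →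
      ∀ N : ℕ, 2 ≤ N →
        (N : ℝ) * starDiscrepancy (fun n => Int.fract ((p : ℝ) ^ n * α)) N ≤
          C * (Real.log (N : ℝ)) ^ 2 := by
  have hp0 : (0 : ℝ) < p := by exact_mod_cast hp.pos
  have hlog2 : 0 < Real.log 2 := Real.log_pos (by norm_num)
  -- `14 * p` is `7 * p` twice, for the complete necklaces and the partial one; `p ^ 2 / Real.log 2
  -- ^ 2` comes from squaring `pow_mul_log_two_le_log`.
  refine ⟨14 * (p : ℝ) ^ 3 / Real.log 2 ^ 2, by positivity, ?_⟩
  rintro z η u h a ha α - rfl N hN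
  refine mul_starDiscrepancy_le (fun _ => Int.fract_nonneg _) (by omega) fun c hc => ?_
  obtain ⟨m, hm, hle, hlt⟩ := exists_necklace_index hp N
  rw [Finset.sum_Ico_succ_top hm] at hlt
  have h1 := abs_sum_concatenation_le hp h ha hc hm
  have h2 := abs_sum_necklace_prefix_le (h m hm) hp (ha m hm) hc
    (M := N - ∑ j ∈ Finset.Ico 1 m, affineLength p j) (by omega)
  rw [← Nat.add_sub_cancel' hle, sum_range_add_eq, Nat.add_sub_cancel' hle]
  refine (abs_add_le _ _).trans ((add_le_add h1 h2).trans ?_)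
  have h3 := pow_le_pow_left₀ (by positivity) (pow_mul_log_two_le_log hp hm hN hle) 2
  rw [mul_pow, mul_pow] at h3
  rw [div_mul_eq_mul_div, le_div_iff₀ (by positivity)]
  calc _ = 14 * (p : ℝ) * (((p : ℝ) ^ m) ^ 2 * Real.log 2 ^ 2) := by ring
    _ ≤ 14 * p * ((p : ℝ) ^ 2 * Real.log N ^ 2) := by gcongr
    _ = _ := by ring
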